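/- Let $R$ be a linearly ordered associative ring with $1\neq 0$, not necessarily commutative, in which $2$ is invertible. Write $R_+=\{x\in R: x>0\}$, a semiring without zero under the addition and multiplication of $R$, and let $R_+^*$ be the set of elements of $R_+$ that are invertible in $R$. Let $n\ge 3$. Let $G_n(R)$ be the semigroup of all matrices in $GL_n(R)$ with nonnegative entries (their inverses may have negative entries), and let $\Gamma_n(R)$ be the group of invertible elements of the semigroup $G_n(R)$. Let $\mathbf P$ be the subsemigroup of $G_n(R)$ generated by the permutation matrices $S_\sigma=(\delta_{i\sigma(j)})$ for all permutations $\sigma$ of $\{1,\dots,n\}$, the matrices $B_{ij}(x)=I+xE_{ij}$ with $i\ne j$ and $x\in R_+$, and the diagonal matrices $\mathrm{diag}[d_1,\dots,d_n]$ with all $d_i\in R_+^*$. Two matrices $A,B\in G_n(R)$ are called $\mathcal P$-equivalent if there are $k\ge 0$, matrices $A=A_0,A_1,\dots,A_k=B$ in $G_n(R)$ and matrices $P_i,\widetilde P_i,Q_i,\widetilde Q_i\in\mathbf P$ such that $P_iA_i\widetilde P_i=Q_iA_{i+1}\widetilde Q_i$ for $0\le i<k$. Let $GE_n^+(R)$ be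 the subsemigroup of $G_n(R)$ generated by all matrices that are $\mathcal P$-equivalent to a matrix of $\mathbf P$. Theorem. For every automorphism $\Phi$ of the semigroup $G_n(R)$ there exist - a matrix $M\in\Gamma_n(R)$, which is monomial, that is, $M=\mathrm{diag}[d_1,\dots,d_n]S_\sigma$ with all $d_i\in R_+^*$ and $\sigma$ a permutation, - an automorphism $c$ of the semiring $R_+$ (a bijection of $R_+$ that preserves sums and products), and - a central homothety $\Omega$ of $GE_n^+(R)$, that is, a map $\Omega: GE_n^+(R)\to GE_n^+(R)$ of the form $\Omega(X)=\lambda(X)\cdot X$, where $\lambda: GE_n^+(R)\to GE_n^+(R)$ is a semigroup homomorphism with values in the center of $GE_n^+(R)$, such that $\Phi(X)=\Phi_M(\Phi^c(\Omega(X)))$ for all $X\in GE_n^+(R)$. Here $\Phi_M(X)=MXM^{-1}$ and $\Phi^c((x_{ij}))=(c(x_{ij}))$, with $c(0)=0$, are automorphisms of $G_n(R)$. -/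

import Mathlib

set_option linter.unusedSectionVars false

namespace NonnegMat

section OrderedRing

variable {R : Type*} [Ring R] [LinearOrder R] [IsStrictOrderedRing R]

/-- The semiring `R_+` of (strictly) positive elements of a linearly ordered ring. Its addition and
multiplication are the ones of `R`; it has no zero. -/
abbrev Pos (R : Type*) [Ring R] [LinearOrder R] : Type _ := {x : R // 0 < x}

/-- The odd extension to `R` of a map `c : R_+ → R_+`. In particular it sends `0` to `0` and it is
`c` on positive elements. -/
def extendFun (c : Pos R → Pos R) (x : R) : R :=
  if h : 0 < x then (c ⟨x, h⟩ : R)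
  else if h' : 0 < -x then -(c ⟨-x, h'⟩ : R)
  else 0

theorem extendFun_of_pos (c : Pos R → Pos R) {x : R} (h : 0 < x) :
    extendFun c x = c ⟨x, h⟩ := by
  simp [extendFun, h]

theorem extendFun_zero (c : Pos R → Pos R) : extendFun c 0 = 0 := by
  simp [extendFun]

theorem extendFun_nonneg (c : Pos R → Pos R) {x : R} (h : 0 ≤ x) : 0 ≤ extendFun c x := by
  rcases h.eq_or_lt with h | h
  · rw [← h, extendFun_zero]
  · rw [extendFun_of_pos c h]
    exact (c ⟨x, h⟩).2.le

theorem extendFun_sub (c : Pos R ≃+* Pos R) (a b : Pos R) :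
    extendFun c ((a : R) - b) = (c a : R) - c b := by
  rcases lt_trichotomy (a : R) b with h | h | h
  · have h1 : 0 < (b : R) - a := sub_pos.2 h
    have h2 : ¬ 0 < (a : R) - b := not_lt.2 (sub_nonpos.2 h.le)
    have h3 : 0 < -((a : R) - b) := by rwa [neg_sub]
    have h4 : b = (⟨-((a : R) - b), h3⟩ : Pos R) + a := Subtype.ext (by simp)
    have h5 : (c b : R) = c ⟨-((a : R) - b), h3⟩ + c a := by
      conv_lhs => rw [h4, map_add]
      rfl
    simp only [extendFun, dif_neg h2, dif_pos h3]
    rw [h5]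
    abel
  · have : a = b := Subtype.ext h
    subst this
    simp [extendFun_zero]
  · have h1 : 0 < (a : R) - b := sub_pos.2 h
    have h4 : a = (⟨(a : R) - b, h1⟩ : Pos R) + b := Subtype.ext (by simp)
    have h5 : (c a : R) = c ⟨(a : R) - b, h1⟩ + c b := by
      conv_lhs => rw [h4, map_add]
      rfl
    rw [extendFun_of_pos _ h1, h5]
    abel

theorem exists_pos_sub (x : R) : ∃ a b : Pos R, x = (a : R) - b := by
  refine ⟨⟨|x| + x + 1, ?_⟩, ⟨|x| + 1, ?_⟩, ?_⟩
  · have := neg_abs_le x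
    have h : 0 ≤ |x| + x := by
      have := add_le_add_right this |x|
      simpa using this
    exact add_pos_of_nonneg_of_pos h one_pos
  · exact add_pos_of_nonneg_of_pos (abs_nonneg x) one_pos
  · simp only
    abel

theorem extendFun_symm (c : Pos R ≃+* Pos R) (x : R) :
    extendFun c.symm (extendFun c x) = x := by
  obtain ⟨a, b, rfl⟩ := exists_pos_sub x
  rw [extendFun_sub, extendFun_sub]
  simp

/-- An automorphism of the semiring `R_+` extends to an automorphism of the ring `R`. -/
def extend (c : Pos R ≃+* Pos R) : R ≃+* R where
  toFun := extendFun c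
  invFun := extendFun c.symm
  left_inv := extendFun_symm c
  right_inv := extendFun_symm c.symm
  map_mul' x y := by
    obtain ⟨a, b, rfl⟩ := exists_pos_sub x
    obtain ⟨a', b', rfl⟩ := exists_pos_sub y
    have h : ((a : R) - b) * ((a' : R) - b')
        = ((a * a' + b * b' : Pos R) : R) - ((a * b' + b * a' : Pos R) : R) := by
      simp only [Positive.coe_add, Positive.val_mul]
      noncomm_ring
    rw [h, extendFun_sub, extendFun_sub, extendFun_sub]
    simp only [map_add, map_mul, Positive.coe_add, Positive.val_mul]
    noncomm_ring
  map_add' x y := by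
    obtain ⟨a, b, rfl⟩ := exists_pos_sub x
    obtain ⟨a', b', rfl⟩ := exists_pos_sub y
    have h : ((a : R) - b) + ((a' : R) - b')
        = ((a + a' : Pos R) : R) - ((b + b' : Pos R) : R) := by
      simp only [Positive.coe_add]
      abel
    rw [h, extendFun_sub, extendFun_sub, extendFun_sub]
    simp only [map_add, Positive.coe_add]
    abel

end OrderedRing

section Matrices

variable (n : ℕ) (R : Type*) [Ring R] [LinearOrder R] [IsStrictOrderedRing R]

/-- The semigroup `G_n(R)` of the matrices in `GL_n(R)` all of whose entries are nonnegative
(their inverses may have negative entries). -/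
def G : Submonoid (Matrix (Fin n) (Fin n) R)ˣ where
  carrier := {A | ∀ i j, 0 ≤ (A : Matrix (Fin n) (Fin n) R) i j}
  one_mem' i j := by
    rw [Units.val_one, Matrix.one_apply]
    split_ifs
    · exact zero_le_one
    · exact le_rfl
  mul_mem' {A B} hA hB i j := by
    rw [Units.val_mul, Matrix.mul_apply]
    exact Finset.sum_nonneg fun k _ => mul_nonneg (hA i k) (hB k j)

/-- The group `Γ_n(R)` of invertible elements of the semigroup `G_n(R)`. -/
abbrev Gam : Type _ := (G n R)ˣ

variable {n R}

/-- The matrix underlying an element of `G_n(R)`. -/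
def mat (A : G n R) : Matrix (Fin n) (Fin n) R := ((A : (Matrix (Fin n) (Fin n) R)ˣ) : _)

/-- The matrix `S_σ = (δ_{i σ(j)})`. -/
def permMat (R : Type*) [Ring R] (σ : Equiv.Perm (Fin n)) : Matrix (Fin n) (Fin n) R :=
  Matrix.of fun i j => if i = σ j then 1 else 0

/-- The matrix `B_{ij}(x) = I + x E_{ij}`. -/
def B (i j : Fin n) (x : R) : Matrix (Fin n) (Fin n) R := 1 + Matrix.single i j x

/-- Being `diag[d_1, …, d_n]` with all `d_i` positive invertible elements of `R`. -/
def IsPosDiag (A : Matrix (Fin n) (Fin n) R) : Prop :=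
  ∃ d : Fin n → Rˣ, (∀ i, 0 < (d i : R)) ∧ A = Matrix.diagonal fun i => (d i : R)

/-- Monomial matrices: `D S_σ` with `D` diagonal with positive invertible diagonal entries. -/
def IsMonomial (A : Matrix (Fin n) (Fin n) R) : Prop :=
  ∃ (D : Matrix (Fin n) (Fin n) R) (σ : Equiv.Perm (Fin n)), IsPosDiag D ∧ A = D * permMat R σ

variable (n R) in
/-- The subsemigroup `P` of `G_n(R)` generated by the `S_σ`, the `B_{ij}(x)` with `i ≠ j` and
`x > 0`, and the diagonal matrices. -/
def P : Subsemigroup (G n R) :=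
  Subsemigroup.closure
    {A | (∃ σ : Equiv.Perm (Fin n), mat A = permMat R σ) ∨
      (∃ (i j : Fin n) (x : R), i ≠ j ∧ 0 < x ∧ mat A = B i j x) ∨
      IsPosDiag (mat A)}

/-- One step of `P`-equivalence: `P₁ A P₂ = Q₁ A' Q₂` for some `P₁, P₂, Q₁, Q₂ ∈ P`. -/
def PStep (A A' : G n R) : Prop :=
  ∃ P₁ ∈ P n R, ∃ P₂ ∈ P n R, ∃ Q₁ ∈ P n R, ∃ Q₂ ∈ P n R, P₁ * A * P₂ = Q₁ * A' * Q₂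

/-- `P`-equivalence: the matrices are joined by a finite chain of steps in `G_n(R)`. -/
def PEquivalent (A A' : G n R) : Prop := Relation.ReflTransGen PStep A A'

variable (n R) in
/-- The subsemigroup `GE_n^+(R)` of `G_n(R)` generated by all matrices that are `P`-equivalent to
matrices from `P`. -/
def GE : Subsemigroup (G n R) :=
  Subsemigroup.closure {A | ∃ A' ∈ P n R, PEquivalent A A'}

/-- The automorphism `Φ_M : X ↦ M X M⁻¹` of `G_n(R)`, for `M ∈ Γ_n(R)`. -/
def conjAut (M : Gam n R) : G n R ≃* G n R where
  toFun X := M * X * (M⁻¹ : Gam n R)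
  invFun X := (M⁻¹ : Gam n R) * X * M
  left_inv X := by simp [mul_assoc]
  right_inv X := by simp [mul_assoc]
  map_mul' X Y := by simp [mul_assoc]

/-- `X = (x_{ij}) ↦ (c(x_{ij}))` on `G_n(R)`, for an automorphism `c` of `R_+` (with `c(0) = 0`). -/
def entrywiseFun (c : Pos R ≃+* Pos R) (X : G n R) : G n R :=
  ⟨Units.map ((extend c).mapMatrix (m := Fin n)).toMonoidHom (X : (Matrix (Fin n) (Fin n) R)ˣ),
    fun i j => extendFun_nonneg c (X.2 i j)⟩

theorem entrywiseFun_mat (c : Pos R ≃+* Pos R) (X : G n R) (i j : Fin n) :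
    mat (entrywiseFun c X) i j = if h : 0 < mat X i j then (c ⟨mat X i j, h⟩ : R) else 0 := by
  change extendFun c (mat X i j) = _
  have h0 : 0 ≤ mat X i j := X.2 i j
  rcases h0.eq_or_lt with h | h
  · simp [← h, extendFun_zero]
  · simp [h, extendFun_of_pos]

/-- The automorphism `Φ^c` of `G_n(R)`: entrywise application of an automorphism `c` of `R_+`. -/
def entrywiseAut (c : Pos R ≃+* Pos R) : G n R ≃* G n R where
  toFun := entrywiseFun c
  invFun := entrywiseFun c.symm
  left_inv X := by
    apply Subtype.ext
    apply Units.ext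
    ext i j
    exact extendFun_symm c _
  right_inv X := by
    apply Subtype.ext
    apply Units.ext
    ext i j
    exact extendFun_symm c.symm _
  map_mul' X Y := by
    apply Subtype.ext
    exact map_mul (Units.map ((extend c).mapMatrix (m := Fin n)).toMonoidHom) _ _

end Matrices

/-- Central homotheties of a semigroup `S`: maps `x ↦ λ(x) x` with `λ : S → S` a homomorphism whose
values lie in the center of `S`. -/
def IsCentralHomothety {S : Type*} [Semigroup S] (Ω : S → S) : Prop :=
  ∃ l : S →ₙ* S, (∀ x, l x ∈ Subsemigroup.center S) ∧ ∀ x, Ω x = l x * x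

end NonnegMat

/-! Invertible elements of `G n R` are monomial (`exists_mono`), so the action of Φ on Γ_n(R) can be
controlled first. Call γ almost central if each element of Γ_n(R) has a nonzero power commuting with
γ. Automorphisms preserve this property, and because it passes from powers to elements of an ordered
ring (`commute_of_commute_pow`), it singles out the diagonal matrices whose entries commute with all
positive units (`commute_pow_diagG`, `eq_diagG_of_commute_pow`). Hence the matrices diag[1,…,2,…,1]
go to diagonal matrices, and counting rearrangements of the diagonal shows that each image has one
value z in one place and a different value w elsewhere (`exists_map_delta`). This fixes the
permutation part of the image of S_σ; what remains is a cocycle in the torsion-free group of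
positive units, hence a coboundary. Conjugation by a monomial matrix therefore makes Φ fix every S_σ
(`exists_conj_permG`).

The matrices B_ij(x) are then caught by their relations with diag[1,…,2,…,1]: up to transposition
the relations force the image to be elementary (`eq_bG_of_relations`), and a commutator relation
excludes the transpose. The induced map on parameters is an automorphism c of R_+
(`exists_ringEquiv_map_bG`).

After removing c, all S_σ and B_ij(x) are fixed. Diagonal matrices normalize the elementary ones, so
they change only by central scalars. This behaviour is stable under products and, by cancellation,
under P-equivalence, hence holds on `GE n R` (`map_eq_scal_mul_of_mem_GE`); the scalars form the
homothety. -/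

namespace NonnegMat

/-! ### Positive units, monomial and elementary matrices -/

section Basic

variable {R : Type*} [Ring R] [LinearOrder R] [IsStrictOrderedRing R] {n : ℕ}

@[simp] theorem mat_mul (A C : G n R) : mat (A * C) = mat A * mat C := rfl

@[simp] theorem mat_one : mat (1 : G n R) = 1 := rfl

theorem mat_injective : Function.Injective (mat : G n R → Matrix (Fin n) (Fin n) R) :=
  fun _ _ h => Subtype.ext (Units.ext h)

theorem mat_nonneg (A : G n R) (i j : Fin n) : 0 ≤ mat A i j := A.2 i j

theorem isUnit_mat (A : G n R) : IsUnit (mat A) := (A : (Matrix (Fin n) (Fin n) R)ˣ).isUnit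

instance : IsCancelMul (G n R) where
  mul_left_cancel A _ _ h := mat_injective ((isUnit_mat A).mul_left_cancel (congrArg mat h))
  mul_right_cancel A _ _ h := mat_injective ((isUnit_mat A).mul_right_cancel (congrArg mat h))

/-- Positive invertible elements of `R`. -/
abbrev U (R : Type*) [Ring R] [LinearOrder R] [IsStrictOrderedRing R] : Type _ :=
  Units.posSubgroup R

/-- The underlying element of `R`. -/
abbrev U.val (u : U R) : R := ((u : Rˣ) : R)

theorem U.val_pos (u : U R) : 0 < u.val := u.2

theorem U.val_injective : Function.Injective (U.val : U R → R) :=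
  fun _ _ h => Subtype.ext (Units.ext h)

theorem U.val_ne (u : U R) : u.val ≠ 0 := u.val_pos.ne'

@[simp] theorem U.val_mul (u v : U R) : (u * v).val = u.val * v.val := rfl

@[simp] theorem U.val_one : (1 : U R).val = 1 := rfl

@[simp] theorem U.val_mul_inv (u : U R) : u.val * u⁻¹.val = 1 := by
  rw [← U.val_mul, mul_inv_cancel, U.val_one]

/-- A strict inequality between ab and ba propagates to all positive powers of a, since a > 0; no
sign is needed for b. -/
theorem commute_of_commute_pow {a b : R} (ha : 0 < a) {N : ℕ} (hN : N ≠ 0)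
    (h : a ^ N * b = b * a ^ N) : a * b = b * a := by
  have key : ∀ {x y : R}, (x * b < b * y) → 0 < x → 0 < y → x * y = y * x →
      ∀ m : ℕ, m ≠ 0 → x ^ m * b < b * y ^ m := by
    intro x y hxy hx hy hc m hm
    induction m with
    | zero => exact absurd rfl hm
    | succ m ih =>
      rcases Nat.eq_zero_or_pos m with rfl | hm'
      · simpa using hxy
      · calc x ^ (m + 1) * b = x ^ m * (x * b) := by rw [pow_succ, mul_assoc]
          _ < x ^ m * (b * y) := mul_lt_mul_of_pos_left hxy (pow_pos hx m)
          _ = x ^ m * b * y := by rw [mul_assoc]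
          _ < b * y ^ m * y := mul_lt_mul_of_pos_right (ih hm'.ne') hy
          _ = b * y ^ (m + 1) := by rw [pow_succ, mul_assoc]
  rcases lt_trichotomy (a * b) (b * a) with h1 | h1 | h1
  · exact absurd h (key h1 ha ha rfl N hN).ne
  · exact h1
  · have key' : ∀ m : ℕ, m ≠ 0 → b * a ^ m < a ^ m * b := by
      intro m hm
      induction m with
      | zero => exact absurd rfl hm
      | succ m ih =>
        rcases Nat.eq_zero_or_pos m with rfl | hm'
        · simpa using h1
        · calc b * a ^ (m + 1) = b * a ^ m * a := by rw [pow_succ, mul_assoc]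
            _ < a ^ m * b * a := mul_lt_mul_of_pos_right (ih hm'.ne') ha
            _ = a ^ m * (b * a) := by rw [mul_assoc]
            _ < a ^ m * (a * b) := mul_lt_mul_of_pos_left h1 (pow_pos ha m)
            _ = a ^ (m + 1) * b := by rw [pow_succ, mul_assoc]
    exact absurd h.symm (key' N hN).ne

theorem U.eq_one_of_pow_eq_one {u : U R} {N : ℕ} (hN : N ≠ 0) (h : u ^ N = 1) : u = 1 := by
  apply U.val_injective
  have h' : u.val ^ N = 1 := by
    have := congrArg U.val h
    simpa [U.val] using this
  exact (pow_eq_one_iff_of_nonneg u.val_pos.le hN).1 h'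

/-- An element of `G_n(R)` from a nonnegative matrix and its inverse. -/
def mkG (A A' : Matrix (Fin n) (Fin n) R) (h : A * A' = 1) (h' : A' * A = 1)
    (hA : ∀ i j, 0 ≤ A i j) : G n R :=
  ⟨⟨A, A', h, h'⟩, hA⟩

/-- The matrix with entry `u j` at place `(σ j, j)` and `0` elsewhere. -/
def monoMat (u : Fin n → U R) (σ : Equiv.Perm (Fin n)) : Matrix (Fin n) (Fin n) R :=
  Matrix.of fun i j => if i = σ j then (u j).val else 0

theorem monoMat_mul_apply (u : Fin n → U R) (σ : Equiv.Perm (Fin n))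
    (A : Matrix (Fin n) (Fin n) R) (i j : Fin n) :
    (monoMat u σ * A) (σ i) j = (u i).val * A i j := by
  rw [Matrix.mul_apply, Finset.sum_eq_single i]
  · simp [monoMat]
  · intro k _ hk
    simp [monoMat, hk.symm]
  · simp

theorem mul_monoMat_apply (u : Fin n → U R) (σ : Equiv.Perm (Fin n))
    (A : Matrix (Fin n) (Fin n) R) (i j : Fin n) :
    (A * monoMat u σ) i j = A i (σ j) * (u j).val := by
  rw [Matrix.mul_apply, Finset.sum_eq_single (σ j)]
  · simp [monoMat]
  · intro k _ hk
    simp [monoMat, hk]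
  · simp

theorem monoMat_mul (u v : Fin n → U R) (σ τ : Equiv.Perm (Fin n)) :
    monoMat u σ * monoMat v τ = monoMat (fun j => u (τ j) * v j) (σ * τ) := by
  ext i j
  rw [mul_monoMat_apply]
  by_cases h : i = σ (τ j) <;> simp [monoMat, h]

theorem monoMat_one : monoMat (1 : Fin n → U R) 1 = 1 := by
  ext i j
  by_cases h : i = j <;> simp [monoMat, h, Matrix.one_apply]

theorem monoMat_nonneg (u : Fin n → U R) (σ : Equiv.Perm (Fin n)) (i j : Fin n) :
    0 ≤ monoMat u σ i j := by
  simp only [monoMat, Matrix.of_apply]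
  split_ifs
  exacts [(u j).val_pos.le, le_rfl]

/-- Monomial matrices as elements of `G_n(R)`. -/
def monoG (u : Fin n → U R) (σ : Equiv.Perm (Fin n)) : G n R :=
  mkG (monoMat u σ) (monoMat (fun j => (u (σ⁻¹ j))⁻¹) σ⁻¹)
    (by rw [monoMat_mul, ← monoMat_one]; congr 1 <;> ext <;> simp)
    (by rw [monoMat_mul, ← monoMat_one]; congr 1 <;> ext <;> simp)
    (monoMat_nonneg u σ)

@[simp] theorem mat_monoG (u : Fin n → U R) (σ : Equiv.Perm (Fin n)) :
    mat (monoG u σ) = monoMat u σ := rfl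

theorem monoG_mul (u v : Fin n → U R) (σ τ : Equiv.Perm (Fin n)) :
    monoG u σ * monoG v τ = monoG (fun j => u (τ j) * v j) (σ * τ) :=
  mat_injective (monoMat_mul u v σ τ)

theorem monoG_one : monoG (1 : Fin n → U R) 1 = 1 := mat_injective monoMat_one

/-- Monomial matrices as elements of `Γ_n(R)`. -/
def mono (u : Fin n → U R) (σ : Equiv.Perm (Fin n)) : Gam n R where
  val := monoG u σ
  inv := monoG (fun j => (u (σ⁻¹ j))⁻¹) σ⁻¹
  val_inv := by rw [monoG_mul, ← monoG_one]; congr 1 <;> ext <;> simp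
  inv_val := by rw [monoG_mul, ← monoG_one]; congr 1 <;> ext <;> simp

@[simp] theorem val_mono (u : Fin n → U R) (σ : Equiv.Perm (Fin n)) :
    (mono u σ : G n R) = monoG u σ := rfl

theorem mono_mul (u v : Fin n → U R) (σ τ : Equiv.Perm (Fin n)) :
    mono u σ * mono v τ = mono (fun j => u (τ j) * v j) (σ * τ) :=
  Units.ext (monoG_mul u v σ τ)

theorem mono_one : mono (1 : Fin n → U R) 1 = 1 := Units.ext monoG_one

theorem monoG_inj {u v : Fin n → U R} {σ τ : Equiv.Perm (Fin n)} :
    monoG u σ = monoG v τ ↔ u = v ∧ σ = τ := by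
  refine ⟨fun h => ?_, by rintro ⟨rfl, rfl⟩; rfl⟩
  have h' : ∀ i j, monoMat u σ i j = monoMat v τ i j := fun i j =>
    congrFun (congrFun (congrArg mat h) i) j
  have hστ : ∀ j, σ j = τ j := by
    intro j
    by_contra hne
    have := h' (σ j) j
    simp [monoMat, hne] at this
  refine ⟨?_, Equiv.ext hστ⟩
  ext1 j
  have := h' (σ j) j
  apply U.val_injective
  simpa [monoMat, hστ j] using this

theorem mono_inj {u v : Fin n → U R} {σ τ : Equiv.Perm (Fin n)} :
    mono u σ = mono v τ ↔ u = v ∧ σ = τ := by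
  rw [← monoG_inj, ← val_mono, ← val_mono, Units.val_inj]

theorem mono_one_pow (u : Fin n → U R) (N : ℕ) : mono u 1 ^ N = mono (u ^ N) 1 := by
  induction N with
  | zero => rw [pow_zero, pow_zero, mono_one]
  | succ N ih => rw [pow_succ, ih, mono_mul, mul_one, pow_succ]; rfl

/-- When A and its inverse are both nonnegative, each off-diagonal entry of their product is a
vanishing sum of nonnegative terms, so every term is 0. Without zero divisors this leaves one
nonzero entry per row and column. -/
theorem exists_mono (γ : Gam n R) : ∃ u σ, γ = mono u σ := by
  set A := mat (γ : G n R) with hA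
  set A' := mat ((γ⁻¹ : Gam n R) : G n R) with hA'
  have h1 : A * A' = 1 := by rw [hA, hA', ← mat_mul, Units.mul_inv, mat_one]
  have h2 : A' * A = 1 := by rw [hA, hA', ← mat_mul, Units.inv_mul, mat_one]
  have n1 : ∀ i j, 0 ≤ A i j := mat_nonneg _
  have n2 : ∀ i j, 0 ≤ A' i j := mat_nonneg _
  have zero_of : ∀ {C D : Matrix (Fin n) (Fin n) R}, (∀ i j, 0 ≤ C i j) → (∀ i j, 0 ≤ D i j) →
      C * D = 1 → ∀ i j k, i ≠ j → C i k * D k j = 0 := by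
    intro C D hC hD h i j k hij
    have := congrFun (congrFun h i) j
    rw [Matrix.mul_apply, Matrix.one_apply_ne hij,
      Finset.sum_eq_zero_iff_of_nonneg fun k _ => mul_nonneg (hC i k) (hD k j)] at this
    exact this k (Finset.mem_univ k)
  have ex : ∀ j, ∃ i, A' j i * A i j ≠ 0 := by
    intro j
    by_contra! hcon
    have := congrFun (congrFun h2 j) j
    rw [Matrix.mul_apply, Finset.sum_eq_zero fun k _ => hcon k, Matrix.one_apply_eq] at this
    exact zero_ne_one this
  choose s hs using ex
  have hs1 : ∀ j, A' j (s j) ≠ 0 := fun j => left_ne_zero_of_mul (hs j)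
  have hs2 : ∀ j, A (s j) j ≠ 0 := fun j => right_ne_zero_of_mul (hs j)
  have col : ∀ j i, i ≠ s j → A i j = 0 := fun j i hi =>
    (mul_eq_zero.1 (zero_of n1 n2 h1 i (s j) j hi)).resolve_right (hs1 j)
  have row : ∀ j i, i ≠ j → A (s j) i = 0 := fun j i hi =>
    (mul_eq_zero.1 (zero_of n2 n1 h2 j i (s j) hi.symm)).resolve_left (hs1 j)
  have inj : Function.Injective s := by
    intro j j' h
    by_contra hne
    exact hs2 j (by rw [h]; exact row j' j hne)
  have u1 : ∀ j, A (s j) j * A' j (s j) = 1 := by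
    intro j
    have := congrFun (congrFun h1 (s j)) (s j)
    rwa [Matrix.mul_apply, Finset.sum_eq_single j (fun k _ hk => by rw [row j k hk, zero_mul])
      (by simp), Matrix.one_apply_eq] at this
  have u2 : ∀ j, A' j (s j) * A (s j) j = 1 := by
    intro j
    have := congrFun (congrFun h2 j) j
    rwa [Matrix.mul_apply, Finset.sum_eq_single (s j) (fun k _ hk => by rw [col j k hk, mul_zero])
      (by simp), Matrix.one_apply_eq] at this
  refine ⟨fun j => ⟨⟨A (s j) j, A' j (s j), u1 j, u2 j⟩, lt_of_le_of_ne (n1 _ _) (hs2 j).symm⟩,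
    Equiv.ofBijective s (Finite.injective_iff_bijective.1 inj), ?_⟩
  apply Units.ext
  apply mat_injective
  ext i j
  simp only [val_mono, mat_monoG, monoMat, Matrix.of_apply, Equiv.ofBijective_apply]
  split_ifs with h
  · rw [h]
  · exact col j i h

/-- The permutation matrix `S_σ` as an element of `Γ_n(R)`. -/
abbrev permG (R : Type*) [Ring R] [LinearOrder R] [IsStrictOrderedRing R]
    (σ : Equiv.Perm (Fin n)) : Gam n R := mono 1 σ

theorem mat_permG (σ : Equiv.Perm (Fin n)) : mat (permG R σ : G n R) = permMat R σ := by
  ext i j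
  simp [permG, monoMat, permMat]

/-- Diagonal matrices as elements of `Γ_n(R)`. -/
abbrev diagG (u : Fin n → U R) : Gam n R := mono u 1

theorem mat_diagG (u : Fin n → U R) :
    mat (diagG u : G n R) = Matrix.diagonal fun i => (u i).val := by
  ext i j
  by_cases h : i = j
  · subst h
    simp [diagG, monoMat]
  · simp [diagG, monoMat, h]

theorem isPosDiag_iff (A : G n R) : IsPosDiag (mat A) ↔ ∃ u : Fin n → U R, A = diagG u := by
  constructor
  · rintro ⟨d, hd, h⟩
    refine ⟨fun i => ⟨d i, hd i⟩, mat_injective ?_⟩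
    rw [h, mat_diagG]
  · rintro ⟨u, rfl⟩
    exact ⟨fun i => (u i : Rˣ), fun i => (u i).2, mat_diagG u⟩

theorem isMonomial_gam (γ : Gam n R) : IsMonomial (mat (γ : G n R)) := by
  obtain ⟨u, σ, rfl⟩ := exists_mono γ
  refine ⟨mat (diagG fun i => u (σ⁻¹ i) : G n R), σ, (isPosDiag_iff _).2 ⟨_, rfl⟩, ?_⟩
  rw [← mat_permG, ← mat_mul, ← Units.val_mul, mono_mul]
  congr 2
  ext; simp

/-- The elementary matrix `B_{ij}(x)` as an element of `G_n(R)`. -/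
def bG (i j : Fin n) (hij : i ≠ j) (x : Pos R) : G n R :=
  mkG (B i j x) (B i j (-x))
    (by simp [B, mul_add, add_mul, Matrix.single_mul_single_of_ne, hij.symm, add_assoc,
      ← Matrix.single_add])
    (by simp [B, mul_add, add_mul, Matrix.single_mul_single_of_ne, hij.symm, add_assoc,
      ← Matrix.single_add])
    (fun k l => by
      simp only [B, Matrix.add_apply, Matrix.one_apply, Matrix.single_apply]
      have := x.2.le
      split_ifs <;> simp [this, add_nonneg])

@[simp] theorem mat_bG (i j : Fin n) (hij : i ≠ j) (x : Pos R) : mat (bG i j hij x) = B i j (x : R) :=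
  rfl

theorem bG_inj {i j : Fin n} {hij : i ≠ j} {x y : Pos R} (h : bG i j hij x = bG i j hij y) :
    x = y := by
  have := congrFun (congrFun (congrArg mat h) i) j
  simpa [B, hij, Subtype.ext_iff] using this

theorem bG_mul (i j : Fin n) (hij : i ≠ j) (x y : Pos R) :
    bG i j hij x * bG i j hij y = bG i j hij (x + y) := by
  apply mat_injective
  simp [B, mul_add, add_mul, Matrix.single_mul_single_of_ne, hij.symm, Matrix.single_add, add_assoc]

/-- The commutator relation in a form without inverses, usable in the semigroup. It later encodes
the multiplication of R_+. -/
theorem bG_mul_bG {i j k : Fin n} (hij : i ≠ j) (hjk : j ≠ k) (hik : i ≠ k) (x y : Pos R) :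
    bG i j hij x * bG j k hjk y = bG j k hjk y * bG i k hik (x * y) * bG i j hij x := by
  apply mat_injective
  simp [B, mul_add, add_mul, Matrix.single_mul_single_of_ne, hik.symm]
  abel

theorem mono_mul_bG (u : Fin n → U R) (σ : Equiv.Perm (Fin n)) {i j : Fin n} (hij : i ≠ j)
    (x y : Pos R) (h : (u i).val * x = y * (u j).val) :
    (mono u σ : G n R) * bG i j hij x = bG (σ i) (σ j) (σ.injective.ne hij) y * mono u σ := by
  apply mat_injective
  ext k l
  obtain ⟨k, rfl⟩ := σ.surjective k
  simp only [mat_mul, val_mono, mat_monoG, mat_bG, mul_monoMat_apply, monoMat_mul_apply]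
  simp only [B, Matrix.add_apply, Matrix.one_apply, Matrix.single_apply, σ.injective.eq_iff,
    mul_add, add_mul]
  by_cases hkl : k = l
  · subst hkl
    have : ¬ (i = k ∧ j = k) := by rintro ⟨rfl, rfl⟩; exact hij rfl
    simp [this]
  · by_cases h3 : i = k ∧ j = l
    · obtain ⟨rfl, rfl⟩ := h3
      simp [hkl, h]
    · simp [hkl, h3]

theorem permG_mul_bG (σ : Equiv.Perm (Fin n)) {i j : Fin n} (hij : i ≠ j) (x : Pos R) :
    (permG R σ : G n R) * bG i j hij x = bG (σ i) (σ j) (σ.injective.ne hij) x * permG R σ :=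
  mono_mul_bG 1 σ hij x x (by simp)

end Basic

/-! ### Functions with few rearrangements -/

section Combinatorics

/-- The function with value `z` at `p` and `w` elsewhere. -/
def spike {α β : Type*} [DecidableEq α] (z w : β) (p : α) (k : α) : β := if k = p then z else w

@[simp] theorem spike_self {α β : Type*} [DecidableEq α] (z w : β) (p : α) : spike z w p p = z := by
  simp [spike]

theorem spike_of_ne {α β : Type*} [DecidableEq α] (z w : β) {p k : α} (h : k ≠ p) :
    spike z w p k = w := by
  simp [spike, h]

/-- A nonconstant function on `n ≥ 3` points that has at most `n` rearrangements takes all but one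
time the same value. -/
theorem exists_spike_of_few_rearrangements {α β : Type*} [Fintype α] [DecidableEq α]
    (hα : 3 ≤ Fintype.card α) (e : α → β) (f : α → α → β)
    (hf : ∀ π : Equiv.Perm α, ∃ j, e ∘ π = f j) (hne : ∃ a b, e a ≠ e b) :
    ∃ p z w, z ≠ w ∧ e = spike z w p := by
  classical
  have level : ∀ a b, e a ≠ e b → (Finset.univ.filter fun k => e k = e a).card = 1 ∨
      (Finset.univ.filter fun k => ¬ e k = e a).card = 1 := by
    intro a b hab
    let S := {k // e k = e a}
    let S' := {k // ¬ e k = e a}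
    -- The function itself and its swaps across the two level sets: |S|·|S'| + 1 distinct
    -- rearrangements, against at most |S| + |S'| allowed.
    let F : Option (S × S') → α → β := fun o =>
      o.elim e fun q => e ∘ Equiv.swap (q.1 : α) (q.2 : α)
    have hF : Function.Injective F := by
      have val : ∀ (q : S × S') k, F (some q) k = e a ↔
          (k = q.2 ∨ (k ≠ q.1 ∧ e k = e a)) := by
        rintro ⟨⟨i, hi⟩, ⟨j, hj⟩⟩ k
        change e (Equiv.swap i j k) = e a ↔ (k = j ∨ (k ≠ i ∧ e k = e a))
        by_cases h1 : k = i
        · subst h1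
          have : k ≠ j := by rintro rfl; exact hj hi
          simp [hj, this]
        · by_cases h2 : k = j
          · subst h2
            simp [hi]
          · rw [Equiv.swap_apply_of_ne_of_ne h1 h2]
            simp [h1, h2]
      have vnone : ∀ k, F none k = e k := fun k => rfl
      rintro (_ | q) (_ | q') h
      · rfl
      · have h1 := (val q' q'.2).2 (Or.inl rfl)
        rw [← h, vnone] at h1
        exact absurd h1 q'.2.2
      · have h1 := (val q q.2).2 (Or.inl rfl)
        rw [h, vnone] at h1
        exact absurd h1 q.2.2
      · have h2 : q.2 = q'.2 := by
          have h1 := (val q q.2).2 (Or.inl rfl)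
          rw [h, val] at h1
          rcases h1 with h1 | h1
          · exact Subtype.ext h1
          · exact absurd h1.2 q.2.2
        have h3 : q.1 = q'.1 := by
          by_contra hne
          have h1 := (val q' q.1).2 (Or.inr ⟨fun h => hne (Subtype.ext h), q.1.2⟩)
          rw [← h, val] at h1
          rcases h1 with h1 | h1
          · exact q.2.2 (h1 ▸ q.1.2)
          · exact h1.1 rfl
        rw [Prod.ext h3 h2]
    have hF' : ∀ o, ∃ j, F o = f j := by
      rintro (_ | q)
      · exact hf 1
      · exact hf _
    choose g hg using hF'
    have hgi : Function.Injective g := fun o o' h => hF (by rw [hg, hg, h])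
    have hcard := Fintype.card_le_of_injective g hgi
    rw [Fintype.card_option, Fintype.card_prod, Fintype.card_subtype, Fintype.card_subtype] at hcard
    have hsum := Finset.card_filter_add_card_filter_not (s := (Finset.univ : Finset α))
      (fun k => e k = e a)
    rw [Finset.card_univ] at hsum
    have h1 : 0 < (Finset.univ.filter fun k => e k = e a).card :=
      Finset.card_pos.2 ⟨a, by simp⟩
    have h2 : 0 < (Finset.univ.filter fun k => ¬ e k = e a).card :=
      Finset.card_pos.2 ⟨b, by simp [hab.symm]⟩
    generalize (Finset.univ.filter fun k => e k = e a).card = x at *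
    generalize (Finset.univ.filter fun k => ¬ e k = e a).card = y at *
    by_contra! hcon
    have hx : 2 ≤ x := by omega
    have hy : 2 ≤ y := by omega
    nlinarith
  by_cases hinj : Function.Injective e
  · choose g hg using hf
    have hgi : Function.Injective g := fun π π' h => by
      have h1 : e ∘ π = e ∘ π' := by rw [hg, hg, h]
      exact Equiv.ext fun k => hinj (congrFun h1 k)
    have := Fintype.card_le_of_injective g hgi
    rw [Fintype.card_perm] at this
    exact absurd (Nat.lt_factorial_self hα) (not_lt.2 this)
  · obtain ⟨a, a', haa, hne'⟩ : ∃ a a', e a = e a' ∧ a ≠ a' := by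
      simpa [Function.Injective] using hinj
    obtain ⟨b, hab⟩ : ∃ b, e a ≠ e b := by
      by_contra! hcon
      obtain ⟨x, y, hxy⟩ := hne
      exact hxy (by rw [← hcon x, ← hcon y])
    rcases level a b hab with h | h
    · exact absurd (Finset.card_le_one.1 h.le a (by simp) a' (by simp [haa])) hne'
    · refine ⟨b, e b, e a, hab.symm, funext fun k => ?_⟩
      by_cases hk : k = b
      · simp [hk]
      · rw [spike_of_ne _ _ hk]
        by_contra hcon
        exact hk (Finset.card_le_one.1 h.le k (by simp [hcon]) b (by simp [hab.symm]))

end Combinatorics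

/-! ### Automorphisms of the group of monomial matrices -/

section Gam

variable {R : Type*} [Ring R] [LinearOrder R] [IsStrictOrderedRing R] {n : ℕ}

theorem mono_mul_diagG_eq_iff (u v v' : Fin n → U R) (σ : Equiv.Perm (Fin n)) :
    mono u σ * diagG v = diagG v' * mono u σ ↔ ∀ j, u j * v j = v' (σ j) * u j := by
  rw [mono_mul, mono_mul, mono_inj]
  simp [funext_iff]

theorem exists_mono_pow (u : Fin n → U R) (σ : Equiv.Perm (Fin n)) (N : ℕ) :
    ∃ u', mono u σ ^ N = mono u' (σ ^ N) := by
  induction N with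
  | zero => exact ⟨1, by rw [pow_zero, pow_zero, mono_one]⟩
  | succ N ih =>
    obtain ⟨u', h⟩ := ih
    exact ⟨_, by rw [pow_succ, h, mono_mul, pow_succ]⟩

/-- Raising to the order of the permutation part makes h diagonal. -/
theorem commute_pow_diagG (v : Fin n → U R) (hv : ∀ u k, Commute u (v k)) (h : Gam n R) :
    ∃ N : ℕ, N ≠ 0 ∧ Commute (h ^ N) (diagG v) := by
  obtain ⟨u, σ, rfl⟩ := exists_mono h
  refine ⟨orderOf σ, (orderOf_pos σ).ne', ?_⟩
  obtain ⟨u', h'⟩ := exists_mono_pow u σ (orderOf σ)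
  rw [h', pow_orderOf_eq_one]
  exact (mono_mul_diagG_eq_iff _ _ _ _).2 fun j => hv _ _

/-- The element `2`. -/
noncomputable def twoU (h2 : IsUnit (2 : R)) : U R := ⟨h2.unit, by
  rw [Units.mem_posSubgroup]; exact zero_lt_two⟩

theorem val_twoU (h2 : IsUnit (2 : R)) : (twoU h2).val = 2 := rfl

theorem twoU_ne_one (h2 : IsUnit (2 : R)) : twoU h2 ≠ 1 := fun h => by
  have := congrArg U.val h
  rw [val_twoU, U.val_one] at this
  exact (one_lt_two (α := R)).ne' this

theorem commute_twoU (h2 : IsUnit (2 : R)) (u : U R) : Commute u (twoU h2) :=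
  U.val_injective (by rw [U.val_mul, U.val_mul, val_twoU, mul_two, two_mul])

theorem eq_diagG_of_commute_pow (h2 : IsUnit (2 : R)) (γ : Gam n R)
    (hγ : ∀ h : Gam n R, ∃ N : ℕ, N ≠ 0 ∧ Commute (h ^ N) γ) :
    ∃ v, γ = diagG v ∧ ∀ u k, Commute u (v k) := by
  obtain ⟨v, τ, rfl⟩ := exists_mono γ
  have hτ : τ = 1 := by
    ext1 j
    by_contra hj
    rw [Equiv.Perm.one_apply] at hj
    -- If τ moves j, commuting with the N-th power of diag[1,…,2,…,1] would give 2^N = 1.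
    obtain ⟨N, hN, hc⟩ := hγ (diagG (spike (twoU h2) 1 j))
    rw [diagG, mono_one_pow] at hc
    have := (mono_mul_diagG_eq_iff _ _ _ _).1 hc.eq.symm j
    rw [Pi.pow_apply, Pi.pow_apply, spike_self, spike_of_ne _ _ hj, one_pow, one_mul,
      mul_eq_left] at this
    exact twoU_ne_one h2 (U.eq_one_of_pow_eq_one hN this)
  subst hτ
  refine ⟨v, rfl, fun u k => ?_⟩
  obtain ⟨N, hN, hc⟩ := hγ (diagG fun _ => u)
  rw [diagG, mono_one_pow] at hc
  have := congrArg U.val ((mono_mul_diagG_eq_iff _ _ _ _).1 hc.eq k)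
  apply U.val_injective
  refine commute_of_commute_pow u.val_pos hN ?_
  simpa [U.val] using this

/-- The matrix `diag[1, …, 2, …, 1]`. -/
noncomputable abbrev delta (h2 : IsUnit (2 : R)) (i : Fin n) : Gam n R :=
  diagG (spike (twoU h2) 1 i)

theorem commute_spike (h2 : IsUnit (2 : R)) (i : Fin n) (u : U R) (k : Fin n) :
    Commute u (spike (twoU h2) 1 i k) := by
  unfold spike
  split_ifs
  exacts [commute_twoU h2 u, Commute.one_right u]

theorem mono_mul_delta (h2 : IsUnit (2 : R)) (u : Fin n → U R) (σ : Equiv.Perm (Fin n))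
    (i : Fin n) : mono u σ * delta h2 i = delta h2 (σ i) * mono u σ := by
  rw [delta, mono_mul_diagG_eq_iff]
  intro j
  rw [(commute_spike h2 i _ _).eq]
  simp [spike]

theorem exists_map_delta (h2 : IsUnit (2 : R)) (hn : 3 ≤ n) (φ : Gam n R ≃* Gam n R) :
    ∃ (z w : U R) (p : Equiv.Perm (Fin n)), z ≠ w ∧ (∀ u, Commute u z) ∧ (∀ u, Commute u w) ∧
      ∀ i, φ (delta h2 i) = diagG (spike z w (p i)) := by
  have hd : ∀ i, ∃ v, φ (delta h2 i) = diagG v ∧ ∀ u k, Commute u (v k) := by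
    intro i
    refine eq_diagG_of_commute_pow h2 _ fun h => ?_
    obtain ⟨N, hN, hc⟩ := commute_pow_diagG _ (commute_spike h2 i) (φ.symm h)
    refine ⟨N, hN, ?_⟩
    simpa using hc.map φ
  choose v hv hvc using hd
  have conj : ∀ u σ i τ u', φ (mono u σ) = mono u' τ → ∀ k, v (σ i) (τ k) = v i k := by
    intro u σ i τ u' h k
    have h1 := congrArg φ (mono_mul_delta h2 u σ i)
    rw [map_mul, map_mul, h, hv, hv, mono_mul_diagG_eq_iff] at h1
    have h2 := h1 k
    rw [(hvc i _ k).eq] at h2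
    exact (mul_right_cancel h2).symm
  -- Every rearrangement of an image diagonal is again the image of some `delta h2 j`, so there are
  -- at most n of them.
  have conj' : ∀ (π : Equiv.Perm (Fin n)) i, ∃ j, v i ∘ π = v j := by
    intro π i
    obtain ⟨u, σ, h⟩ := exists_mono (φ.symm (permG R π))
    refine ⟨σ⁻¹ i, funext fun k => ?_⟩
    have := conj u σ (σ⁻¹ i) π 1 (by rw [← h, MulEquiv.apply_symm_apply]) k
    simpa using this
  -- A constant image would be central in Γ_n(R), but `delta h2 i` does not commute with a
  -- transposition moving i.
  have nonconst : ∀ i, ∃ a b, v i a ≠ v i b := by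
    intro i
    by_contra! hcon
    obtain ⟨j, hj⟩ : ∃ j, j ≠ i := by
      have : Nontrivial (Fin n) := Fin.nontrivial_iff_two_le.2 (by omega)
      exact exists_ne i
    obtain ⟨u, τ, h⟩ := exists_mono (φ (permG R (Equiv.swap i j)))
    have h1 : permG R (Equiv.swap i j) * delta h2 i = delta h2 i * permG R (Equiv.swap i j) := by
      apply φ.injective
      rw [map_mul, map_mul, hv, h, mono_mul_diagG_eq_iff]
      intro k
      rw [(hvc i _ k).eq, hcon (τ k) k]
    have h3 := (mono_mul_diagG_eq_iff _ _ _ _).1 h1 i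
    rw [Equiv.swap_apply_left, spike_self, spike_of_ne _ _ hj] at h3
    simp at h3
    exact twoU_ne_one h2 h3
  let i₀ : Fin n := ⟨0, by omega⟩
  obtain ⟨p₀, z, w, hzw, hp⟩ := exists_spike_of_few_rearrangements (by simpa using hn) (v i₀) v
    (fun π => conj' π i₀) (nonconst i₀)
  have hz : z = v i₀ p₀ := by rw [hp, spike_self]
  have hw : ∃ k, w = v i₀ k := by
    obtain ⟨k, hk⟩ : ∃ k, k ≠ p₀ := by
      have : Nontrivial (Fin n) := Fin.nontrivial_iff_two_le.2 (by omega)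
      exact exists_ne p₀
    exact ⟨k, by rw [hp, spike_of_ne _ _ hk]⟩
  have all : ∀ i, ∃ q, v i = spike z w q := by
    intro i
    obtain ⟨u', τ, h⟩ := exists_mono (φ (permG R (Equiv.swap i₀ i)))
    refine ⟨τ p₀, funext fun k => ?_⟩
    have := conj _ _ i₀ τ u' h (τ⁻¹ k)
    rw [Equiv.swap_apply_left, hp] at this
    rw [show τ (τ⁻¹ k) = k by simp] at this
    rw [this]
    simp [spike, Equiv.symm_apply_eq]
  choose q hq using all
  have qinj : Function.Injective q := by
    intro i j hij
    by_contra hne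
    have h1 : delta h2 i = delta h2 j := by
      apply φ.injective
      rw [hv, hv, hq, hq, hij]
    have h3 := congrFun (mono_inj.1 h1).1 i
    rw [spike_self, spike_of_ne _ _ hne] at h3
    exact twoU_ne_one h2 h3
  obtain ⟨k, hk⟩ := hw
  exact ⟨z, w, Equiv.ofBijective q (Finite.injective_iff_bijective.1 qinj), hzw,
    fun u => hz ▸ hvc _ _ _, fun u => hk ▸ hvc _ _ _, fun i => by rw [hv, hq]; rfl⟩

theorem perm_of_map_permG (h2 : IsUnit (2 : R)) {φ : Gam n R ≃* Gam n R} {z w : U R}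
    {p : Equiv.Perm (Fin n)} (hzw : z ≠ w) (hz : ∀ u, Commute u z)
    (hp : ∀ i, φ (delta h2 i) = diagG (spike z w (p i))) {σ τ : Equiv.Perm (Fin n)}
    {u : Fin n → U R} (h : φ (permG R σ) = mono u τ) : τ * p = p * σ := by
  ext1 i
  have h1 := congrArg φ (mono_mul_delta h2 1 σ i)
  rw [map_mul, map_mul, h, hp, hp, mono_mul_diagG_eq_iff] at h1
  have h3 := h1 (p i)
  have hc : ∀ u, Commute u (spike z w (p i) (p i)) := by rw [spike_self]; exact hz
  rw [(hc _).eq, spike_self] at h3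
  have h4 := mul_right_cancel h3
  by_contra hne
  rw [spike_of_ne (p := p (σ i)) (k := τ (p i)) _ _ hne] at h4
  exact hzw h4

theorem exists_conj_permG (h2 : IsUnit (2 : R)) (hn : 3 ≤ n) (φ : Gam n R ≃* Gam n R) :
    ∃ M : Gam n R, ∀ σ, φ (permG R σ) = M * permG R σ * M⁻¹ := by
  obtain ⟨z, w, p, hzw, hz, -, hp⟩ := exists_map_delta h2 hn φ
  have ex : ∀ σ, ∃ u : Fin n → U R, φ (permG R σ) = mono (u ∘ p.symm) (p * σ * p⁻¹) := by
    intro σ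
    obtain ⟨u, τ, h⟩ := exists_mono (φ (permG R σ))
    refine ⟨u ∘ p, ?_⟩
    rw [h, ← perm_of_map_permG h2 hzw hz hp h, mul_inv_cancel_right, mono_inj]
    exact ⟨funext fun k => by simp, rfl⟩
  choose u hu using ex
  have coc : ∀ σ τ j, u (σ * τ) j = u σ (τ j) * u τ j := by
    intro σ τ j
    have h1 : φ (permG R (σ * τ)) = φ (permG R σ) * φ (permG R τ) := by
      rw [← map_mul, mono_mul]
      exact congrArg φ (mono_inj.2 ⟨funext fun _ => (mul_one 1).symm, rfl⟩)
    rw [hu, hu, hu, mono_mul, mono_inj] at h1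
    have := congrFun h1.1 (p j)
    simpa using this
  let o : Fin n := ⟨0, by omega⟩
  -- On the stabilizer of `o` the cocycle is a homomorphism from a finite group to a torsion-free
  -- one.
  have fix : ∀ ρ : Equiv.Perm (Fin n), ρ o = o → u ρ o = 1 := by
    intro ρ hρ
    have hpow : ∀ N : ℕ, u (ρ ^ N) o = u ρ o ^ N := by
      intro N
      induction N with
      | zero =>
        have := coc 1 1 o
        simpa using this
      | succ N ih => rw [pow_succ, coc, hρ, ih, pow_succ]
    refine U.eq_one_of_pow_eq_one (orderOf_pos ρ).ne' ?_
    rw [← hpow, pow_orderOf_eq_one, ← pow_zero ρ, hpow, pow_zero]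
  have main : ∀ σ j, u σ j * u (Equiv.swap o j) o = u (Equiv.swap o (σ j)) o := by
    intro σ j
    have h1 := coc σ (Equiv.swap o j) o
    rw [Equiv.swap_apply_left] at h1
    -- Write σ·(o j) = (o σj)·ρ with ρ fixing `o`; then ρ contributes nothing.
    have h3 := coc (Equiv.swap o (σ j)) (Equiv.swap o (σ j) * (σ * Equiv.swap o j)) o
    have h4 : (Equiv.swap o (σ j) * (σ * Equiv.swap o j)) o = o := by simp
    rw [h4, fix _ h4, mul_one, ← mul_assoc, Equiv.swap_mul_self, one_mul, h1] at h3
    exact h3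
  refine ⟨mono (fun j => u (Equiv.swap o j) o) p, fun σ => ?_⟩
  rw [eq_mul_inv_iff_mul_eq, hu, mono_mul, mono_mul, mono_inj]
  refine ⟨funext fun j => ?_, by group⟩
  simpa using main σ j

/-- The permutation of the positions of z now commutes with every permutation, so it is the identity
as n ≥ 3. -/
theorem map_delta_of_map_permG (h2 : IsUnit (2 : R)) (hn : 3 ≤ n) (φ : Gam n R ≃* Gam n R)
    (hφ : ∀ σ, φ (permG R σ) = permG R σ) :
    ∃ (z w : U R), z ≠ w ∧ Commute w z ∧ ∀ i, φ (delta h2 i) = diagG (spike z w i) := by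
  obtain ⟨z, w, p, hzw, hz, -, hp⟩ := exists_map_delta h2 hn φ
  refine ⟨z, w, hzw, hz w, fun i => ?_⟩
  suffices p i = i by rw [hp, this]
  by_contra hne
  obtain ⟨k, hk⟩ := Fin.exists_ne_and_ne_of_two_lt i (p i) hn
  have := congrArg (fun σ : Equiv.Perm (Fin n) => σ i)
    (perm_of_map_permG h2 hzw hz hp (hφ (Equiv.swap (p i) k)))
  simp only [Equiv.Perm.mul_apply, Equiv.swap_apply_left] at this
  rw [Equiv.swap_apply_of_ne_of_ne (fun h => hne h.symm) hk.1.symm] at this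
  exact hk.2 this

end Gam

/-! ### Elementary matrices characterized by relations -/

section Elementary

variable {R : Type*} [Ring R] [LinearOrder R] [IsStrictOrderedRing R] {n : ℕ}

theorem eq_zero_of_intertwine {x z w : R} (hx : 0 ≤ x) (hzw : z ≠ w)
    (h1 : z * x = x * w) (h2 : w * x = x * z) : x = 0 := by
  by_contra hne
  have hx' : 0 < x := lt_of_le_of_ne hx (Ne.symm hne)
  rcases hzw.lt_or_gt with h | h
  · refine lt_irrefl (z * x) ?_
    calc z * x < w * x := mul_lt_mul_of_pos_right h hx'
      _ = x * z := h2
      _ < x * w := mul_lt_mul_of_pos_left h hx'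
      _ = z * x := h1.symm
  · refine lt_irrefl (w * x) ?_
    calc w * x < z * x := mul_lt_mul_of_pos_right h hx'
      _ = x * w := h1
      _ < x * z := mul_lt_mul_of_pos_left h hx'
      _ = w * x := h2.symm

theorem eq_zero_of_intertwine_sq {x z w : R} (hz : 0 < z) (hw : 0 < w) (hx : 0 ≤ x) (hzw : z ≠ w)
    (h1 : z * x = x * w) (h2 : w * w * x = x * (z * w)) : x = 0 := by
  by_contra hne
  have hx' : 0 < x := lt_of_le_of_ne hx (Ne.symm hne)
  have h3 : z * z * x = x * (w * w) := by rw [mul_assoc, h1, ← mul_assoc, h1, mul_assoc]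
  rcases hzw.lt_or_gt with h | h
  · refine lt_irrefl (w * w * x) ?_
    calc w * w * x = x * (z * w) := h2
      _ < x * (w * w) := mul_lt_mul_of_pos_left (mul_lt_mul_of_pos_right h hw) hx'
      _ = z * z * x := h3.symm
      _ < w * w * x := mul_lt_mul_of_pos_right (mul_lt_mul'' h h hz.le hz.le) hx'
  · refine lt_irrefl (w * w * x) ?_
    calc w * w * x < z * z * x := mul_lt_mul_of_pos_right (mul_lt_mul'' h h hw.le hw.le) hx'
      _ = x * (w * w) := h3
      _ < x * (z * w) := mul_lt_mul_of_pos_left (mul_lt_mul_of_pos_right h hw) hx'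
      _ = w * w * x := h2.symm

theorem eq_zero_of_intertwine_sq' {x z w : R} (hz : 0 < z) (hw : 0 < w) (hx : 0 ≤ x) (hzw : z ≠ w)
    (h1 : w * x = x * z) (h2 : w * z * x = x * (w * w)) : x = 0 := by
  by_contra hne
  have hx' : 0 < x := lt_of_le_of_ne hx (Ne.symm hne)
  have h3 : w * w * x = x * (z * z) := by rw [mul_assoc, h1, ← mul_assoc, h1, mul_assoc]
  rcases hzw.lt_or_gt with h | h
  · refine lt_irrefl (w * w * x) ?_
    calc w * w * x = x * (z * z) := h3
      _ < x * (w * w) := mul_lt_mul_of_pos_left (mul_lt_mul'' h h hz.le hz.le) hx'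
      _ = w * z * x := h2.symm
      _ < w * w * x := mul_lt_mul_of_pos_right (mul_lt_mul_of_pos_left h hw) hx'
  · refine lt_irrefl (w * w * x) ?_
    calc w * w * x < w * z * x := mul_lt_mul_of_pos_right (mul_lt_mul_of_pos_left h hw) hx'
      _ = x * (w * w) := h2
      _ < x * (z * z) := mul_lt_mul_of_pos_left (mul_lt_mul'' h h hw.le hw.le) hx'
      _ = w * w * x := h3.symm

theorem exists_row_ne_zero (A : G n R) (k : Fin n) : ∃ b, mat A k b ≠ 0 := by
  by_contra! hcon
  obtain ⟨C, hC⟩ := (isUnit_mat A).exists_right_inv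
  have := congrFun (congrFun hC k) k
  rw [Matrix.mul_apply, Finset.sum_eq_zero fun b _ => by rw [hcon b, zero_mul],
    Matrix.one_apply_eq] at this
  exact zero_ne_one this

theorem exists_col_ne_zero (A : G n R) (k : Fin n) : ∃ b, mat A b k ≠ 0 := by
  by_contra! hcon
  obtain ⟨C, hC⟩ := (isUnit_mat A).exists_left_inv
  have := congrFun (congrFun hC k) k
  rw [Matrix.mul_apply, Finset.sum_eq_zero fun b _ => by rw [hcon b, mul_zero],
    Matrix.one_apply_eq] at this
  exact zero_ne_one this

theorem eq_one_of_mul_self {a : R} (ha : a ≠ 0) (h : a = a * a) : a = 1 :=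
  (mul_right_eq_self₀.1 h.symm).resolve_right ha

theorem diagG_mul_apply (v : Fin n → U R) (A : G n R) (a b : Fin n) :
    mat ((diagG v : G n R) * A) a b = (v a).val * mat A a b :=
  monoMat_mul_apply v 1 (mat A) a b

theorem mul_diagG_apply (v : Fin n → U R) (A : G n R) (a b : Fin n) :
    mat (A * (diagG v : G n R)) a b = mat A a b * (v b).val :=
  mul_monoMat_apply v 1 (mat A) a b

/-- The algebra behind the shape of the `2 × 2` block of the image of an elementary matrix. -/
theorem block_offDiag_eq_zero {a b c d z w : R} (ha : 0 ≤ a) (hb : 0 ≤ b) (hc : 0 ≤ c) (hd : 0 ≤ d)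
    (hzw : z ≠ w) (hwb : w * b = b * w) (hwc : w * c = c * w)
    (haa : a = a * a + b * c)
    (hab : z * b = (a * b + b * d) * w) (hca : w * c = (c * a + d * c) * z) : b = 0 ∨ c = 0 := by
  by_contra! hne
  have hb' : 0 < b := lt_of_le_of_ne hb hne.1.symm
  have hc' : 0 < c := lt_of_le_of_ne hc hne.2.symm
  have hbc : 0 < b * c := mul_pos hb' hc'
  -- Thus bc commutes with a, which yields z·bc = X·w and w·bc = X·z with the same X ≥ 0. The order
  -- of z and w is then preserved on the left and reversed on the right.
  have hbc' : b * c = a - a * a := by nth_rewrite 1 [haa]; abel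
  have hcomm : b * c * a = a * (b * c) := by rw [hbc']; noncomm_ring
  have e1 : z * (b * c) = (a * (b * c) + b * d * c) * w := by
    rw [← mul_assoc, hab, mul_assoc, hwc]; noncomm_ring
  have e2 : w * (b * c) = (a * (b * c) + b * d * c) * z := by
    rw [← mul_assoc, hwb, mul_assoc, hca, ← hcomm]; noncomm_ring
  have hX : 0 ≤ a * (b * c) + b * d * c := by positivity
  rcases hzw.lt_or_gt with h | h
  · have h1 := mul_lt_mul_of_pos_right h hbc
    rw [e1, e2] at h1
    exact absurd (mul_le_mul_of_nonneg_left h.le hX) h1.not_ge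
  · have h1 := mul_lt_mul_of_pos_right h hbc
    rw [e1, e2] at h1
    exact absurd (mul_le_mul_of_nonneg_left h.le hX) h1.not_ge

/-- The hypotheses imitate B_ij(x): diag[1,…,2,…,1] commutes with it for 2 in place k, doubles x for
place i, and halves 2x for place j, where B_ij(2x) = B_ij(x)². Order arguments kill all entries
outside the diagonal and the block on {i, j}. -/
theorem eq_bG_of_relations (hn : 3 ≤ n) {z w : U R} (hzw : z ≠ w) (hc : Commute w z) (A : G n R)
    (hA : A ≠ 1) {i j : Fin n} (hij : i ≠ j)
    (hk : ∀ k, k ≠ i → k ≠ j →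
      (diagG (spike z w k) : G n R) * A = A * (diagG (spike z w k) : G n R))
    (hi : (diagG (spike z w i) : G n R) * A = A * A * (diagG (spike z w i) : G n R))
    (hj : (diagG (spike z w j) : G n R) * (A * A) = A * (diagG (spike z w j) : G n R)) :
    ∃ y, A = bG i j hij y ∨ A = bG j i hij.symm y := by
  have hn0 : ∀ a b, 0 ≤ mat A a b := mat_nonneg A
  have hzw' : z.val ≠ w.val := fun h => hzw (U.val_injective h)
  have hc' : w.val * z.val = z.val * w.val := congrArg U.val hc.eq
  have ek : ∀ k, k ≠ i → k ≠ j → ∀ a b,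
      (spike z w k a).val * mat A a b = mat A a b * (spike z w k b).val := fun k h1 h2 a b => by
    rw [← diagG_mul_apply, ← mul_diagG_apply, hk k h1 h2]
  have ei : ∀ a b, (spike z w i a).val * mat A a b = mat (A * A) a b * (spike z w i b).val :=
    fun a b => by rw [← diagG_mul_apply, ← mul_diagG_apply, hi]
  have ej : ∀ a b, (spike z w j a).val * mat (A * A) a b = mat A a b * (spike z w j b).val :=
    fun a b => by rw [← diagG_mul_apply, ← mul_diagG_apply, hj]
  -- Eliminating A² between `hi` and `hj`: A commutes with the product of the two diagonals.
  have eij : ∀ a b, (spike z w j a).val * (spike z w i a).val * mat A a b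
      = mat A a b * ((spike z w j b).val * (spike z w i b).val) := fun a b => by
    rw [mul_assoc, ei, ← mul_assoc, ej, mul_assoc]
  have row : ∀ k, k ≠ i → k ≠ j → ∀ b, b ≠ k → mat A k b = 0 := by
    intro k hki hkj b hbk
    have h1 := ek k hki hkj k b
    rw [spike_self, spike_of_ne _ _ hbk] at h1
    by_cases hb : b = i ∨ b = j
    · have h2 := eij k b
      rw [spike_of_ne _ _ hkj, spike_of_ne _ _ hki] at h2
      refine eq_zero_of_intertwine_sq z.val_pos w.val_pos (hn0 k b) hzw' h1 (h2.trans ?_)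
      rcases hb with rfl | rfl
      · rw [spike_self, spike_of_ne _ _ hij, hc']
      · rw [spike_self, spike_of_ne _ _ hij.symm]
    · push Not at hb
      have h2 := ek b hb.1 hb.2 k b
      rw [spike_self, spike_of_ne _ _ hbk.symm] at h2
      exact eq_zero_of_intertwine (hn0 k b) hzw' h1 h2
  have col : ∀ k, k ≠ i → k ≠ j → ∀ b, b = i ∨ b = j → mat A b k = 0 := by
    intro k hki hkj b hb
    have hbk : b ≠ k := by rintro rfl; tauto
    have h1 := ek k hki hkj b k
    rw [spike_self, spike_of_ne _ _ hbk] at h1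
    have h2 := eij b k
    rw [spike_of_ne _ _ hkj, spike_of_ne _ _ hki] at h2
    refine eq_zero_of_intertwine_sq' z.val_pos w.val_pos (hn0 b k) hzw' h1 (Eq.trans ?_ h2)
    rcases hb with rfl | rfl
    · rw [spike_self, spike_of_ne _ _ hij]
    · rw [spike_self, spike_of_ne _ _ hij.symm, hc']
  have diag : ∀ k, k ≠ i → k ≠ j → mat A k k = 1 := by
    intro k hki hkj
    have hk0 : mat A k k ≠ 0 := by
      obtain ⟨b, hb⟩ := exists_row_ne_zero A k
      by_cases hbk : b = k
      · rwa [hbk] at hb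
      · exact absurd (row k hki hkj b hbk) hb
    have h1 := eij k k
    rw [spike_of_ne _ _ hkj, spike_of_ne _ _ hki, ← pow_two] at h1
    have h2 := commute_of_commute_pow w.val_pos two_ne_zero h1
    have h3 := ei k k
    rw [spike_of_ne _ _ hki, h2, mat_mul, Matrix.mul_apply,
      Finset.sum_eq_single k (fun b _ hb => by rw [row k hki hkj b hb, zero_mul]) (by simp)] at h3
    exact eq_one_of_mul_self hk0 (mul_right_cancel₀ w.val_ne h3)
  have sq : ∀ a b, (a = i ∨ a = j) →
      mat (A * A) a b = mat A a i * mat A i b + mat A a j * mat A j b := by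
    intro a b ha
    rw [mat_mul, Matrix.mul_apply]
    exact Finset.sum_eq_add i j hij
      (fun k _ h => by rw [col k h.1 h.2 a ha, zero_mul]) (by simp) (by simp)
  -- A third index m gives a diagonal equal to w on the block, so w commutes with the block entries.
  obtain ⟨m, hmi, hmj⟩ := Fin.exists_ne_and_ne_of_two_lt i j hn
  have wcomm : ∀ a b, (a = i ∨ a = j) → (b = i ∨ b = j) →
      w.val * mat A a b = mat A a b * w.val := by
    intro a b ha hb
    have h1 := ek m hmi hmj a b
    rwa [spike_of_ne _ _ (by rintro rfl; tauto), spike_of_ne _ _ (by rintro rfl; tauto)] at h1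
  have hii : mat A i i = mat A i i * mat A i i + mat A i j * mat A j i := by
    have h1 := ej i i
    rw [spike_of_ne _ _ hij, ← wcomm i i (by simp) (by simp), sq i i (by simp)] at h1
    exact (mul_left_cancel₀ w.val_ne h1).symm
  have hjj : mat A j j = mat A j i * mat A i j + mat A j j * mat A j j := by
    have h1 := ei j j
    rw [spike_of_ne _ _ hij.symm, wcomm j j (by simp) (by simp), sq j j (by simp)] at h1
    exact mul_right_cancel₀ w.val_ne h1
  have hoff : mat A i j = 0 ∨ mat A j i = 0 := by
    have h1 := ei i j
    rw [spike_self, spike_of_ne _ _ hij.symm, sq i j (by simp)] at h1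
    have h2 := ei j i
    rw [spike_self, spike_of_ne _ _ hij.symm, sq j i (by simp)] at h2
    exact block_offDiag_eq_zero (hn0 i i) (hn0 i j) (hn0 j i) (hn0 j j) hzw'
      (wcomm i j (by simp) (by simp)) (wcomm j i (by simp) (by simp)) hii h1 h2
  have hdi : mat A i i ≠ 0 := by
    intro h0
    rcases hoff with h | h
    · obtain ⟨b, hb⟩ := exists_row_ne_zero A i
      by_cases h1 : b = i
      · exact hb (h1 ▸ h0)
      · by_cases h2 : b = j
        · exact hb (h2 ▸ h)
        · exact hb (col b h1 h2 i (by simp))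
    · obtain ⟨b, hb⟩ := exists_col_ne_zero A i
      by_cases h1 : b = i
      · exact hb (h1 ▸ h0)
      · by_cases h2 : b = j
        · exact hb (h2 ▸ h)
        · exact hb (row b h1 h2 i (Ne.symm h1))
  have hdj : mat A j j ≠ 0 := by
    intro h0
    rcases hoff with h | h
    · obtain ⟨b, hb⟩ := exists_col_ne_zero A j
      by_cases h1 : b = i
      · exact hb (h1 ▸ h)
      · by_cases h2 : b = j
        · exact hb (h2 ▸ h0)
        · exact hb (row b h1 h2 j (Ne.symm h2))
    · obtain ⟨b, hb⟩ := exists_row_ne_zero A j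
      by_cases h1 : b = i
      · exact hb (h1 ▸ h)
      · by_cases h2 : b = j
        · exact hb (h2 ▸ h0)
        · exact hb (col b h1 h2 j (by simp))
  have hii' : mat A i i = 1 :=
    eq_one_of_mul_self hdi (hii.trans (by rcases hoff with h | h <;> simp [h]))
  have hjj' : mat A j j = 1 :=
    eq_one_of_mul_self hdj (hjj.trans (by rcases hoff with h | h <;> simp [h]))
  have dall : ∀ k, mat A k k = 1 := by
    intro k
    by_cases h1 : k = i
    · rw [h1, hii']
    · by_cases h2 : k = j
      · rw [h2, hjj']
      · exact diag k h1 h2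
  have off : ∀ a b, a ≠ b → ¬ (a = i ∧ b = j) → ¬ (a = j ∧ b = i) → mat A a b = 0 := by
    intro a b hab h1 h2
    by_cases ha : a = i ∨ a = j
    · exact col b (by rintro rfl; tauto) (by rintro rfl; tauto) a ha
    · push Not at ha
      exact row a ha.1 ha.2 b hab.symm
  have fin : ∀ (p q : Fin n) (hpq : p ≠ q), mat A q p = 0 →
      (∀ a b, a ≠ b → ¬ (a = p ∧ b = q) → ¬ (a = q ∧ b = p) → mat A a b = 0) →
      ∃ y, A = bG p q hpq y := by
    intro p q hpq h0 hoff'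
    have hpq0 : mat A p q ≠ 0 := by
      intro h
      apply hA
      apply mat_injective
      ext a b
      rw [mat_one]
      by_cases hab : a = b
      · rw [hab, dall, Matrix.one_apply_eq]
      · rw [Matrix.one_apply_ne hab]
        by_cases h1 : a = p ∧ b = q
        · rw [h1.1, h1.2, h]
        · by_cases h2 : a = q ∧ b = p
          · rw [h2.1, h2.2, h0]
          · exact hoff' a b hab h1 h2
    refine ⟨⟨mat A p q, lt_of_le_of_ne (hn0 p q) hpq0.symm⟩, mat_injective ?_⟩
    ext a b
    simp only [mat_bG, B, Matrix.add_apply, Matrix.one_apply, Matrix.single_apply]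
    by_cases hab : a = b
    · subst hab
      have : ¬ (p = a ∧ q = a) := by rintro ⟨rfl, rfl⟩; exact hpq rfl
      simp [this, dall]
    · by_cases h1 : p = a ∧ q = b
      · obtain ⟨rfl, rfl⟩ := h1
        simp [hab]
      · by_cases h2 : a = q ∧ b = p
        · obtain ⟨rfl, rfl⟩ := h2
          simp [hab, h0]
        · simp only [hab, h1, if_false, add_zero]
          exact hoff' a b hab (fun h => h1 ⟨h.1.symm, h.2.symm⟩) h2
  rcases hoff with h | h
  · obtain ⟨y, hy⟩ := fin j i hij.symm h fun a b hab h1 h2 => off a b hab h2 h1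
    exact ⟨y, Or.inr hy⟩
  · obtain ⟨y, hy⟩ := fin i j hij h off
    exact ⟨y, Or.inl hy⟩

end Elementary

/-! ### Automorphisms fixing the permutation matrices -/

section Normalized

variable {R : Type*} [Ring R] [LinearOrder R] [IsStrictOrderedRing R] {n : ℕ}

theorem diagG_mul_bG (v : Fin n → U R) {i j : Fin n} (hij : i ≠ j) (x y : Pos R)
    (h : (v i).val * x = y * (v j).val) :
    (diagG v : G n R) * bG i j hij x = bG i j hij y * (diagG v : G n R) :=
  mono_mul_bG v 1 hij x y h

theorem bG_ne_one {i j : Fin n} (hij : i ≠ j) (x : Pos R) : bG i j hij x ≠ 1 := by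
  intro h
  have := congrFun (congrFun (congrArg mat h) i) j
  simp only [mat_bG, B, mat_one, Matrix.add_apply, Matrix.one_apply_ne hij, zero_add,
    Matrix.single_apply_same] at this
  exact x.2.ne' this

theorem exists_perm_apply_eq {α : Type*} [DecidableEq α] {i j i' j' : α} (h : i ≠ j)
    (h' : i' ≠ j') : ∃ σ : Equiv.Perm α, σ i = i' ∧ σ j = j' := by
  refine ⟨Equiv.swap (Equiv.swap i i' j) j' * Equiv.swap i i', ?_, by simp⟩
  rw [Equiv.Perm.mul_apply, Equiv.swap_apply_left]
  refine Equiv.swap_apply_of_ne_of_ne (fun h1 => h ?_) h'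
  rw [← Equiv.swap_apply_left i i'] at h1
  exact (Equiv.swap i i').injective (by simpa using h1)

variable (Φ : G n R ≃* G n R)

theorem map_bG_eq_or (h2 : IsUnit (2 : R)) (hn : 3 ≤ n)
    (hΦ : ∀ σ : Equiv.Perm (Fin n), Φ (permG R σ : G n R) = permG R σ)
    {i j : Fin n} (hij : i ≠ j) (x : Pos R) :
    ∃ y, Φ (bG i j hij x) = bG i j hij y ∨ Φ (bG i j hij x) = bG j i hij.symm y := by
  obtain ⟨z, w, hzw, hc, hd⟩ := map_delta_of_map_permG h2 hn (Units.mapEquiv Φ)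
    fun σ => Units.ext (hΦ σ)
  have hd' : ∀ k : Fin n, Φ (delta h2 k : G n R) = (diagG (spike z w k) : G n R) := fun k =>
    congrArg Units.val (hd k)
  refine eq_bG_of_relations hn hzw hc _ ?_ hij ?_ ?_ ?_
  · rw [← map_one Φ, Φ.injective.ne_iff]
    exact bG_ne_one hij x
  · intro k hki hkj
    rw [← hd', ← map_mul, ← map_mul]
    congr 1
    apply diagG_mul_bG
    rw [spike_of_ne _ _ hki.symm, spike_of_ne _ _ hkj.symm, U.val_one, one_mul, mul_one]
  · rw [← hd', ← map_mul, ← map_mul, ← map_mul, bG_mul]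
    congr 1
    apply diagG_mul_bG
    rw [spike_self, spike_of_ne _ _ hij.symm, U.val_one, val_twoU, two_mul, mul_one]
    rfl
  · rw [← hd', ← map_mul, ← map_mul, ← map_mul, bG_mul]
    congr 1
    apply diagG_mul_bG
    rw [spike_self, spike_of_ne _ _ hij, U.val_one, val_twoU, one_mul, mul_two]
    rfl

theorem map_bG_perm (hΦ : ∀ σ : Equiv.Perm (Fin n), Φ (permG R σ : G n R) = permG R σ)
    {i j p q : Fin n} (hij : i ≠ j) (hpq : p ≠ q) {x y : Pos R} (h : Φ (bG i j hij x) = bG p q hpq y) (σ : Equiv.Perm (Fin n)) :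
    Φ (bG (σ i) (σ j) (σ.injective.ne hij) x) = bG (σ p) (σ q) (σ.injective.ne hpq) y := by
  have h1 := congrArg Φ (permG_mul_bG σ hij x)
  rw [map_mul, map_mul, hΦ, h, permG_mul_bG] at h1
  exact (mul_right_cancel h1).symm

theorem map_bG_ne_transpose (h2 : IsUnit (2 : R)) (hn : 3 ≤ n)
    (hΦ : ∀ σ : Equiv.Perm (Fin n), Φ (permG R σ : G n R) = permG R σ)
    {i j : Fin n} (hij : i ≠ j) (x y : Pos R) :
    Φ (bG i j hij x) ≠ bG j i hij.symm y := by
  intro h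
  obtain ⟨k, hki, hkj⟩ := Fin.exists_ne_and_ne_of_two_lt i j hn
  have hk : Φ (bG i k hki.symm x) = bG k i hki y := by
    have h1 := map_bG_perm Φ hΦ hij hij.symm h (Equiv.swap j k)
    simpa only [Equiv.swap_apply_left, Equiv.swap_apply_of_ne_of_ne hij hki.symm] using h1
  have h1 := congrArg Φ (bG_mul_bG hij hkj.symm hki.symm x 1)
  rw [map_mul, map_mul, map_mul, mul_one, h, hk] at h1
  -- In either case compare the (k, i) entries: 0 on the left, y or y + uy on the right.
  obtain ⟨u, hu | hu⟩ := map_bG_eq_or Φ h2 hn hΦ hkj.symm 1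
  all_goals
    rw [hu] at h1
    have h3 := congrFun (congrFun (congrArg mat h1) k) i
    have hy := y.2
    have huy := mul_pos u.2 y.2
    simp [B, mul_add, add_mul, Matrix.single_mul_single_of_ne, hij, hki, hkj,
      hij.symm, hki.symm, hkj.symm] at h3
  · exact hy.ne h3
  · exact (add_pos hy huy).ne h3

theorem exists_map_bG (h2 : IsUnit (2 : R)) (hn : 3 ≤ n)
    (hΦ : ∀ σ : Equiv.Perm (Fin n), Φ (permG R σ : G n R) = permG R σ) :
    ∃ c : Pos R → Pos R, ∀ i j hij x, Φ (bG i j hij x) = bG i j hij (c x) := by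
  have key : ∀ i j hij x, ∃ y, Φ (bG i j hij x) = bG i j hij y := by
    intro i j hij x
    obtain ⟨y, hy | hy⟩ := map_bG_eq_or Φ h2 hn hΦ hij x
    · exact ⟨y, hy⟩
    · exact absurd hy (map_bG_ne_transpose Φ h2 hn hΦ hij x y)
  have h01 : (⟨0, by omega⟩ : Fin n) ≠ ⟨1, by omega⟩ := by simp
  choose c hc using key _ _ h01
  refine ⟨c, fun i j hij x => ?_⟩
  obtain ⟨σ, rfl, rfl⟩ := exists_perm_apply_eq h01 hij
  exact map_bG_perm Φ hΦ h01 h01 (hc x) σ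

theorem exists_ringEquiv_map_bG (h2 : IsUnit (2 : R)) (hn : 3 ≤ n)
    (hΦ : ∀ σ : Equiv.Perm (Fin n), Φ (permG R σ : G n R) = permG R σ) :
    ∃ c : Pos R ≃+* Pos R, ∀ i j hij x, Φ (bG i j hij x) = bG i j hij (c x) := by
  obtain ⟨c, hc⟩ := exists_map_bG Φ h2 hn hΦ
  obtain ⟨c', hc'⟩ := exists_map_bG Φ.symm h2 hn fun σ => by
    rw [MulEquiv.symm_apply_eq, hΦ]
  have h01 : (⟨0, by omega⟩ : Fin n) ≠ ⟨1, by omega⟩ := by simp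
  have h12 : (⟨1, by omega⟩ : Fin n) ≠ ⟨2, by omega⟩ := by simp
  have h02 : (⟨0, by omega⟩ : Fin n) ≠ ⟨2, by omega⟩ := by simp
  refine ⟨⟨⟨c, c', fun x => ?_, fun x => ?_⟩, fun x y => ?_, fun x y => ?_⟩, hc⟩
  · apply bG_inj (hij := h01)
    rw [← hc', ← hc, MulEquiv.symm_apply_apply]
  · apply bG_inj (hij := h01)
    rw [← hc, ← hc', MulEquiv.apply_symm_apply]
  -- Multiplicativity of c comes from the commutator relation, additivity from B_ij(x)B_ij(y) =
  -- B_ij(x + y).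
  · have h := congrArg Φ (bG_mul_bG h01 h12 h02 x y)
    rw [map_mul, map_mul, map_mul, hc, hc, hc, bG_mul_bG h01 h12 h02] at h
    exact (bG_inj (mul_left_cancel (mul_right_cancel h))).symm
  · apply bG_inj (hij := h01)
    rw [← hc, ← bG_mul, map_mul, hc, hc, bG_mul]

theorem mat_entrywiseAut (c : Pos R ≃+* Pos R) (X : G n R) :
    mat (entrywiseAut c X) = (extend c).mapMatrix (mat X) := rfl

theorem extend_coe (c : Pos R ≃+* Pos R) (x : Pos R) : extend c x = c x :=
  extendFun_of_pos c x.2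

theorem entrywiseAut_bG (c : Pos R ≃+* Pos R) {i j : Fin n} (hij : i ≠ j) (x : Pos R) :
    entrywiseAut c (bG i j hij x) = bG i j hij (c x) := by
  apply mat_injective
  rw [mat_entrywiseAut, mat_bG, mat_bG, B, B, map_add, map_one, RingEquiv.mapMatrix_apply]
  rw [Matrix.map_single, extend_coe]

theorem entrywiseAut_permG (c : Pos R ≃+* Pos R) (σ : Equiv.Perm (Fin n)) :
    entrywiseAut c (permG R σ : G n R) = permG R σ := by
  apply mat_injective
  rw [mat_entrywiseAut, mat_permG]
  ext i j
  by_cases h : i = σ j <;> simp [permMat, h]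

end Normalized

/-! ### Central scalars and the homothety -/

section Scalars

variable {R : Type*} [Ring R] [LinearOrder R] [IsStrictOrderedRing R] {n : ℕ}

/-- Scalar matrices. -/
abbrev scal (n : ℕ) (r : U R) : G n R := (diagG fun _ => r : Gam n R)

theorem scal_mul (r s : U R) : scal n (r * s) = scal n r * scal n s := by
  rw [scal, scal, scal, ← Units.val_mul, mono_mul, one_mul]

theorem scal_one : scal n (1 : U R) = 1 := monoG_one

/-- Positive units that are central in `R`. -/
def centralU (R : Type*) [Ring R] [LinearOrder R] [IsStrictOrderedRing R] : Subgroup (U R) where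
  carrier := {r | ∀ x : R, Commute r.val x}
  one_mem' x := by simp
  mul_mem' {r s} hr hs x := by
    rw [U.val_mul]
    exact (hr x).mul_left (hs x)
  inv_mem' {r} hr x := Commute.units_inv_left (hr x)

theorem commute_scal {r : U R} (hr : r ∈ centralU R) (A : G n R) : Commute (scal n r) A := by
  apply mat_injective
  ext a b
  rw [diagG_mul_apply, mul_diagG_apply]
  exact hr _

theorem scal_mem_P (r : U R) : scal n r ∈ P n R :=
  Subsemigroup.subset_closure (Or.inr (Or.inr ((isPosDiag_iff _).2 ⟨_, rfl⟩)))

theorem P_le_GE : P n R ≤ GE n R := fun A hA =>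
  Subsemigroup.subset_closure ⟨A, hA, Relation.ReflTransGen.refl⟩

theorem eq_scal_of_commute_bG (hn : 2 ≤ n) (γ : Gam n R)
    (h : ∀ i j hij x, (γ : G n R) * bG i j hij x = bG i j hij x * (γ : G n R)) :
    ∃ r ∈ centralU R, (γ : G n R) = scal n r := by
  obtain ⟨t, τ, rfl⟩ := exists_mono γ
  have key : ∀ i j, i ≠ j → ∀ x : Pos R, τ i = i ∧ (t i).val * x = x * (t j).val := by
    intro i j hij x
    have h1 := congrFun (congrFun (congrArg mat (h i j hij x)) (τ i)) j
    rw [mat_mul, mat_mul, val_mono, mat_monoG, monoMat_mul_apply, mul_monoMat_apply] at h1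
    simp only [mat_bG, B, Matrix.add_apply, Matrix.one_apply_ne hij, Matrix.single_apply_same,
      Matrix.one_apply_ne (τ.injective.ne hij), zero_add] at h1
    have h0 : (t i).val * (x : R) ≠ 0 := (mul_pos (t i).val_pos x.2).ne'
    by_cases hτ : i = τ i ∧ j = τ j
    · refine ⟨hτ.1.symm, ?_⟩
      rwa [← hτ.1, ← hτ.2, Matrix.single_apply_same] at h1
    · rw [Matrix.single_apply_of_ne (h := hτ), zero_mul] at h1
      exact absurd h1 h0
  have : Nontrivial (Fin n) := Fin.nontrivial_iff_two_le.2 hn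
  have hτ : τ = 1 := by
    ext1 i
    obtain ⟨j, hj⟩ := exists_ne i
    exact (key i j hj.symm 1).1
  have const : ∀ i j, t i = t j := by
    intro i j
    by_cases hij : i = j
    · rw [hij]
    · have := (key i j hij 1).2
      apply U.val_injective
      simpa using this
  obtain ⟨i, j, hij⟩ := exists_pair_ne (Fin n)
  refine ⟨t i, fun x => ?_, ?_⟩
  · have hpos : ∀ y : Pos R, Commute (t i).val (y : R) := fun y => by
      have := (key i j hij y).2
      rwa [const j i] at this
    obtain ⟨a, b, rfl⟩ := exists_pos_sub x
    exact (hpos a).sub_right (hpos b)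
  · rw [hτ, show t = fun _ => t i from funext fun k => const k i]

variable {Ψ : G n R ≃* G n R}

theorem map_eq_scal_mul {X Y : G n R}
    (hX : ∃ r ∈ centralU R, Ψ X = scal n r * X) (hY : ∃ r ∈ centralU R, Ψ Y = scal n r * Y) :
    ∃ r ∈ centralU R, Ψ (X * Y) = scal n r * (X * Y) := by
  obtain ⟨r, hr, hX⟩ := hX
  obtain ⟨s, hs, hY⟩ := hY
  refine ⟨r * s, mul_mem hr hs, ?_⟩
  rw [map_mul, hX, hY, scal_mul, mul_assoc, ← mul_assoc X, ← (commute_scal hs X).eq]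
  simp only [mul_assoc]

/-- Descent from a product to a factor by cancellation, needed to go back along a P-equivalence. -/
theorem eq_scal_mul_of_map_mul_left {X Y : G n R}
    (hX : ∃ r ∈ centralU R, Ψ X = scal n r * X)
    (hXY : ∃ r ∈ centralU R, Ψ (X * Y) = scal n r * (X * Y)) :
    ∃ r ∈ centralU R, Ψ Y = scal n r * Y := by
  obtain ⟨r, hr, hX⟩ := hX
  obtain ⟨s, hs, hXY⟩ := hXY
  refine ⟨r⁻¹ * s, mul_mem (inv_mem hr) hs, mul_left_cancel (a := scal n r * X) ?_⟩
  rw [← hX, ← map_mul, hXY, hX, (commute_scal hr X).eq, scal_mul, mul_assoc X,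
    ← mul_assoc (scal n r), ← mul_assoc (scal n r), ← scal_mul, mul_inv_cancel, scal_one, one_mul,
    ← mul_assoc, ← mul_assoc, (commute_scal hs X).eq]

theorem eq_scal_mul_of_map_mul_right {X Y : G n R}
    (hY : ∃ r ∈ centralU R, Ψ Y = scal n r * Y)
    (hXY : ∃ r ∈ centralU R, Ψ (X * Y) = scal n r * (X * Y)) :
    ∃ r ∈ centralU R, Ψ X = scal n r * X := by
  obtain ⟨r, hr, hY⟩ := hY
  obtain ⟨s, hs, hXY⟩ := hXY
  refine ⟨s * r⁻¹, mul_mem hs (inv_mem hr), mul_right_cancel (b := scal n r * Y) ?_⟩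
  rw [← hY, ← map_mul, hXY, hY, ← mul_assoc, ← mul_assoc, mul_assoc (scal n (s * r⁻¹)) X,
    ← (commute_scal hr X).eq, ← mul_assoc, ← scal_mul, inv_mul_cancel_right]

theorem map_diagG_eq_scal_mul (hn : 2 ≤ n) (hB : ∀ i j hij x, Ψ (bG i j hij x) = bG i j hij x)
    (u : Fin n → U R) : ∃ r ∈ centralU R, Ψ (diagG u : G n R) = scal n r * (diagG u : G n R) := by
  have h : ∀ i j hij x, ((Units.mapEquiv Ψ (diagG u) * (diagG u)⁻¹ : Gam n R) : G n R) *
      bG i j hij x =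
        bG i j hij x * ((Units.mapEquiv Ψ (diagG u) * (diagG u)⁻¹ : Gam n R) : G n R) := by
    intro i j hij x
    -- Chosen so that D·B_ij(y) = B_ij(x)·D. As both elementary matrices are fixed, Ψ(D)D⁻¹ commutes
    -- with B_ij(x).
    let y : Pos R := ⟨(u i)⁻¹.val * x * (u j).val,
      mul_pos (mul_pos (U.val_pos _) x.2) (U.val_pos _)⟩
    have h1 : (diagG u : G n R) * bG i j hij y = bG i j hij x * (diagG u : G n R) := by
      apply diagG_mul_bG
      change (u i).val * ((u i)⁻¹.val * x * (u j).val) = _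
      rw [← mul_assoc, ← mul_assoc, U.val_mul_inv, one_mul]
    have h3 : (((diagG u)⁻¹ : Gam n R) : G n R) * bG i j hij x =
        bG i j hij y * (((diagG u)⁻¹ : Gam n R) : G n R) := by
      rw [Units.inv_mul_eq_iff_eq_mul, ← mul_assoc, h1, mul_assoc, Units.mul_inv, mul_one]
    have h4 := congrArg Ψ h1
    rw [map_mul, map_mul, hB, hB] at h4
    rw [Units.val_mul, mul_assoc, h3, ← mul_assoc, ← mul_assoc]
    congr 1
  obtain ⟨r, hr, h⟩ := eq_scal_of_commute_bG hn _ h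
  refine ⟨r, hr, ?_⟩
  rw [← h, Units.val_mul, Units.inv_mul_cancel_right]
  rfl

theorem map_eq_scal_mul_of_mem_P (hn : 2 ≤ n)
    (hS : ∀ σ : Equiv.Perm (Fin n), Ψ (permG R σ : G n R) = permG R σ)
    (hB : ∀ i j hij x, Ψ (bG i j hij x) = bG i j hij x) {X : G n R} (hX : X ∈ P n R) :
    ∃ r ∈ centralU R, Ψ X = scal n r * X := by
  induction hX using Subsemigroup.closure_induction with
  | mem X hX =>
    rcases hX with ⟨σ, h⟩ | ⟨i, j, x, hij, hx, h⟩ | h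
    · rw [← mat_permG] at h
      rw [mat_injective h, hS]
      exact ⟨1, one_mem _, by rw [scal_one, one_mul]⟩
    · rw [mat_injective (h.trans (mat_bG i j hij ⟨x, hx⟩).symm), hB]
      exact ⟨1, one_mem _, by rw [scal_one, one_mul]⟩
    · obtain ⟨u, rfl⟩ := (isPosDiag_iff _).1 h
      exact map_diagG_eq_scal_mul hn hB u
  | mul X Y _ _ hX hY => exact map_eq_scal_mul hX hY

theorem map_eq_scal_mul_of_mem_GE (hn : 2 ≤ n)
    (hS : ∀ σ : Equiv.Perm (Fin n), Ψ (permG R σ : G n R) = permG R σ)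
    (hB : ∀ i j hij x, Ψ (bG i j hij x) = bG i j hij x) {X : G n R} (hX : X ∈ GE n R) :
    ∃ r ∈ centralU R, Ψ X = scal n r * X := by
  have hP : ∀ {X}, X ∈ P n R → ∃ r ∈ centralU R, Ψ X = scal n r * X :=
    map_eq_scal_mul_of_mem_P hn hS hB
  induction hX using Subsemigroup.closure_induction with
  | mem X hX =>
    obtain ⟨X', hX', h⟩ := hX
    induction h using Relation.ReflTransGen.head_induction_on with
    | refl => exact hP hX'
    | head h _ ih =>
      obtain ⟨P₁, hP₁, P₂, hP₂, Q₁, hQ₁, Q₂, hQ₂, h⟩ := h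
      -- The product Q₁A'Q₂ is under control; since it equals P₁AP₂, stripping P₂ and P₁ leaves A.
      have h1 := map_eq_scal_mul (map_eq_scal_mul (hP hQ₁) ih) (hP hQ₂)
      rw [← h] at h1
      exact eq_scal_mul_of_map_mul_left (hP hP₁) (eq_scal_mul_of_map_mul_right (hP hP₂) h1)
  | mul X Y _ _ hX hY => exact map_eq_scal_mul hX hY

theorem exists_centralHomothety
    (h : ∀ X ∈ GE n R, ∃ r ∈ centralU R, Ψ X = scal n r * X) :
    ∃ Ω : GE n R → GE n R, IsCentralHomothety Ω ∧ ∀ X : GE n R, Ψ X = Ω X := by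
  choose r hr hΨ using fun X : GE n R => h X X.2
  let l : GE n R → GE n R := fun X => ⟨scal n (r X), P_le_GE (scal_mem_P _)⟩
  refine ⟨fun X => l X * X, ⟨⟨l, fun X Y => Subtype.ext ?_⟩, fun X => ?_, fun X => rfl⟩, hΨ⟩
  · change scal n (r (X * Y)) = scal n (r X) * scal n (r Y)
    have h1 := hΨ (X * Y)
    rw [MulMemClass.coe_mul, map_mul, hΨ, hΨ] at h1
    apply mul_right_cancel (b := (X : G n R) * Y)
    rw [← h1, mul_assoc, mul_assoc, ← mul_assoc (X : G n R),
      ← (commute_scal (hr Y) (X : G n R)).eq, mul_assoc]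
  · rw [Subsemigroup.mem_center_iff]
    exact fun Y => Subtype.ext (commute_scal (hr X) (Y : G n R)).eq.symm

end Scalars

end NonnegMat

theorem mainTheorem1 {R : Type*} [Ring R] [LinearOrder R] [IsStrictOrderedRing R]
    (h2 : IsUnit (2 : R)) {n : ℕ} (hn : 3 ≤ n)
    (Φ : NonnegMat.G n R ≃* NonnegMat.G n R) :
    ∃ (M : NonnegMat.Gam n R) (c : NonnegMat.Pos R ≃+* NonnegMat.Pos R)
      (Ω : NonnegMat.GE n R → NonnegMat.GE n R),
      NonnegMat.IsMonomial (NonnegMat.mat (M : NonnegMat.G n R)) ∧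
      NonnegMat.IsCentralHomothety Ω ∧
      ∀ X : NonnegMat.GE n R,
        Φ (X : NonnegMat.G n R) =
          NonnegMat.conjAut M (NonnegMat.entrywiseAut c (Ω X : NonnegMat.G n R)) := by
  open NonnegMat in
  obtain ⟨M, hM⟩ := exists_conj_permG h2 hn (Units.mapEquiv Φ)
  have hS : ∀ σ : Equiv.Perm (Fin n),
      (Φ.trans (conjAut M).symm) (permG R σ : G n R) = permG R σ := by
    intro σ
    rw [MulEquiv.trans_apply, MulEquiv.symm_apply_eq]
    exact congrArg Units.val (hM σ)
  obtain ⟨c, hc⟩ := exists_ringEquiv_map_bG _ h2 hn hS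
  obtain ⟨Ω, hΩ, hΨ⟩ := exists_centralHomothety
    (Ψ := (Φ.trans (conjAut M).symm).trans (entrywiseAut c).symm) fun X hX =>
      map_eq_scal_mul_of_mem_GE (by omega)
        (fun σ => by rw [MulEquiv.trans_apply, hS, MulEquiv.symm_apply_eq, entrywiseAut_permG])
        (fun i j hij x => by
          rw [MulEquiv.trans_apply, hc, MulEquiv.symm_apply_eq, entrywiseAut_bG]) hX
  refine ⟨M, c, Ω, isMonomial_gam M, hΩ, fun X => ?_⟩
  rw [← hΨ, MulEquiv.trans_apply, MulEquiv.apply_symm_apply, MulEquiv.trans_apply,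
    MulEquiv.apply_symm_apply]
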